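/- \textbf{Proposition (Device failure, $A>1$).} Let $A>1$ be the number of access points, let $W>0$ be the bandwidth, and let all links have the same average SNR $\rho^{(1)}=\dots=\rho^{(A)}=\rho>0$, with $\mathbf G=\operatorname{diag}(\rho^{(1)},\dots,\rho^{(A)})$. Let $0<\sigma_E<1$, and let the channel be $\mathbf h=\hat{\mathbf h}+\tilde{\mathbf h}\in\mathbb C^A$, where the $2A$ entries of the channel estimate $\hat{\mathbf h}$ and of the estimation error $\tilde{\mathbf h}$ are independent, with $\hat h^{(a)}\sim\mathcal{CN}(0,1-\sigma_E^2)$ and $\tilde h^{(a)}\sim\mathcal{CN}(0,\sigma_E^2)$ (circularly symmetric complex Gaussian). Let $R=W\log_2(1+\hat{\mathbf h}^*\mathbf G\hat{\mathbf h})$ be the selected rate and $C=W\log_2(1+\mathbf h^*\mathbf G\mathbf h)$ the mutual information. Then the probability of device failure is \[ \mathbb P(R>C)=\frac12-\frac12\left[\frac{\sigma_E^2}{4-3\sigma_E^2}\right]^{A/2}\bigl|P_{A-1}(x)\bigr|-\sum_{a=1}^{A-1}\frac{(A+a-1)!}{(A-1)!}\left[\frac{\sigma_E^2}{4-3\sigma_E^2}\right]^{A/2}\bigl|P_{A-1}^{-a}(x)\bigr|,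 \qquad x=\frac{2-\sigma_E^2}{\sqrt{4\sigma_E^2-3\sigma_E^4}}, \] where, for integers $n,m\ge 0$ and $x>1$, \[ P_n^{-m}(x)=\frac1{m!}\left(\frac{x-1}{x+1}\right)^{m/2}{}_2F_1\!\left(-n,\,n+1;\,m+1;\,\tfrac{1-x}{2}\right) \] is the associated Legendre function of the first kind and $P_n=P_n^{0}$. -/

import Mathlib

open MeasureTheory ProbabilityTheory
open scoped Matrix NNReal

noncomputable section

namespace DeviceFailure

/-- The circularly symmetric complex Gaussian law `CN(0, v)`: real and imaginary parts are
independent real centred Gaussians of variance `v / 2` each. -/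
def complexGaussian (v : ℝ≥0) : Measure ℂ :=
  ((gaussianReal 0 (v / 2)).prod (gaussianReal 0 (v / 2))).map
    (fun p : ℝ × ℝ => (p.1 : ℂ) + (p.2 : ℂ) * Complex.I)

/-- The diagonal matrix `G` of the average SNRs of the links between the `A` access points and
the device. -/
def snrMatrix {A : ℕ} (ρ : Fin A → ℝ) : Matrix (Fin A) (Fin A) ℂ :=
  Matrix.diagonal fun a => (ρ a : ℂ)

/-- The received SNR `g* G g` under transmit beamforming for the channel vector `g`. The product
is a complex number with zero imaginary part. -/
def beamformingSNR {A : ℕ} (ρ : Fin A → ℝ) (g : Fin A → ℂ) : ℝ :=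
  (star g ⬝ᵥ (snrMatrix ρ *ᵥ g)).re

/-- The quantity `W log₂ (1 + g* G g)`, in bits per second over a bandwidth `W`. At the true
channel it is the mutual information `C`; at the channel estimate it is the selected rate `R`. -/
def rate {A : ℕ} (W : ℝ) (ρ : Fin A → ℝ) (g : Fin A → ℂ) : ℝ :=
  W * Real.logb 2 (1 + beamformingSNR ρ g)

/-- The associated Legendre function of the first kind `P_n^{-m}` of degree `n` and order `-m`, on
the half-line `x ≥ 1` (the branch that is real there):
`P_n^{-m}(x) = ((x - 1) / (x + 1)) ^ (m / 2) / m! * ₂F₁(-n, n + 1; m + 1; (1 - x) / 2)`.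
The hypergeometric series is a finite sum because `n` is a natural number. -/
def legendreP (n m : ℕ) (x : ℝ) : ℝ :=
  ((x - 1) / (x + 1)) ^ ((m : ℝ) / 2) / (m.factorial : ℝ)
    * ordinaryHypergeometric (-(n : ℝ)) ((n : ℝ) + 1) ((m : ℝ) + 1) ((1 - x) / 2)

end DeviceFailure

end

/-!
Dividing by `W` and by the common SNR, device failure is the event `∑ₐ |uₐ|² > ∑ₐ |uₐ + vₐ|²`, where
`u` is the estimate and `v` the error. Put `s = σE²` and `r = √(4s - 3s²)`. A direct Gaussian
integration (`integral_exp_gainDrop`) shows that one summand `|u|² - |u + v|²` has characteristic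
function `1 / (1 + s (i τ + (1 - s) τ²))`, which factors as that of a difference of two independent
exponentials with means `(r - s) / 2` and `(r + s) / 2`. So the failure probability is that of a sum
of `A` exponentials of the first kind exceeding a sum of `A` of the second kind
(`map_sum_gainDrop_eq_expDiffMeasure`).

Instead of Gamma densities, the comparison uses memorylessness. The partial fraction decomposition
of the product of the two characteristic functions says that the difference of two competing
exponentials is a mixture of what remains of either one (`expDiffMeasure_succ_succ`). This is a
Pascal recursion in the two numbers of summands, and it yields the binomial tail
`∑_{i < A} C(2A - 1, i) qⁱ p^(2A - 1 - i)` with `p = (1 - t) / 2`, `q = (1 + t) / 2`, `t = s / r`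
(`expDiffMeasure_Ioi`).

It remains to see the tail as a sum of Legendre functions at `x = (t + t⁻¹) / 2`. With `n = A - 1`,
consider the monomials `C(n + j - k, j) C(n + k - j, k) p^(j + k) q^(2n - j - k)` for `0 ≤ j, k ≤ n`.
Along the diagonal `j - k = ±a` they sum to a multiple of `P_n^{-a}(x)`, by a polynomial Pfaff
transformation (`factorial_mul_legendreP`). Along an antidiagonal `j + k = m ≤ n` they sum to
`∑_{i ≤ m} C(2n + 1, i) p^m q^(2n - m)`, by a convolution identity for binomial coefficients
(`sum_antidiagonal_choose_mul_choose`); multiplied by `q - p = t`, this telescopes to the difference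
of the two halves of `(p + q)^(2n + 1) = 1` (`sub_mul_sum_pairTerm`). Comparing the two ways to sum
the square gives the formula (`binomial_tail_eq_legendreP`).
-/

namespace DeviceFailure

/-! ### Competing sums of exponentials -/

theorem ofReal_sub_mul_I_ne_zero {r : ℝ} (hr : 0 < r) (t : ℝ) : (r : ℂ) - t * Complex.I ≠ 0 := by
  intro h; have := congrArg Complex.re h; simp at this; linarith

theorem ofReal_add_mul_I_ne_zero {r : ℝ} (hr : 0 < r) (t : ℝ) : (r : ℂ) + t * Complex.I ≠ 0 := by
  intro h; have := congrArg Complex.re h; simp at this; linarith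

theorem charFun_expMeasure {r : ℝ} (hr : 0 < r) (t : ℝ) :
    charFun (expMeasure r) t = r / (r - t * Complex.I) := by
  have hd : ∀ x : ℝ, (exponentialPDF r x).toReal • Complex.exp (t * x * Complex.I)
      = (Set.Ici (0 : ℝ)).indicator
        (fun x : ℝ => (r : ℂ) * Complex.exp ((-(r - t * Complex.I)) * x)) x := by
    intro x
    by_cases hx : 0 ≤ x
    · rw [exponentialPDF_of_nonneg hx, ENNReal.toReal_ofReal (by positivity),
        Set.indicator_of_mem (by simpa using hx), Complex.real_smul]
      push_cast
      rw [mul_assoc, ← Complex.exp_add]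
      congr 2; ring
    · rw [exponentialPDF_of_neg (not_le.1 hx), Set.indicator_of_notMem (by simpa using hx)]
      simp
  have hm : Measurable (exponentialPDF r) := (measurable_exponentialPDFReal r).ennreal_ofReal
  have hE : expMeasure r = volume.withDensity (exponentialPDF r) := rfl
  rw [charFun_apply_real, hE, integral_withDensity_eq_integral_toReal_smul hm
    (ae_of_all _ fun x => by simp [exponentialPDF])]
  simp_rw [hd]
  rw [integral_indicator measurableSet_Ici, integral_Ici_eq_integral_Ioi, integral_const_mul,
    integral_exp_mul_complex_Ioi (by simpa using hr)]
  rw [Complex.ofReal_zero, mul_zero, Complex.exp_zero, neg_div_neg_eq]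
  ring

theorem expMeasure_Iic_zero {r : ℝ} (hr : 0 < r) : expMeasure r (Set.Iic 0) = 0 := by
  have := isProbabilityMeasure_expMeasure hr
  have h := cdf_expMeasure_eq hr 0
  rw [cdf_eq_real] at h
  simpa [measureReal_def, ENNReal.toReal_eq_zero_iff, measure_ne_top] using h

/-- The law of `-X`, for `X` exponential with rate `r`. -/
noncomputable def negExpMeasure (r : ℝ) : Measure ℝ := (expMeasure r).map Neg.neg

theorem isProbabilityMeasure_negExpMeasure {r : ℝ} (hr : 0 < r) :
    IsProbabilityMeasure (negExpMeasure r) :=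
  have := isProbabilityMeasure_expMeasure hr
  Measure.isProbabilityMeasure_map measurable_neg.aemeasurable

theorem charFun_negExpMeasure {r : ℝ} (hr : 0 < r) (t : ℝ) :
    charFun (negExpMeasure r) t = r / (r + t * Complex.I) := by
  have h : (Neg.neg : ℝ → ℝ) = fun x => (-1) * x := by ext x; simp
  rw [negExpMeasure, h, charFun_map_mul, charFun_expMeasure hr]
  push_cast
  congr 1; ring

theorem negExpMeasure_Ici_zero {r : ℝ} (hr : 0 < r) : negExpMeasure r (Set.Ici 0) = 0 := by
  rw [negExpMeasure, Measure.map_apply measurable_neg measurableSet_Ici]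
  simpa using expMeasure_Iic_zero hr

/-- The law of `X₁ + ⋯ + X_a - Y₁ - ⋯ - Y_b` with all variables independent, the `X`s exponential
of rate `α` and the `Y`s exponential of rate `β`. -/
noncomputable def expDiffMeasure (α β : ℝ) (a b : ℕ) : Measure ℝ :=
  (fun ν => expMeasure α ∗ ν)^[a] ((fun ν => negExpMeasure β ∗ ν)^[b] (Measure.dirac 0))

section expDiff

variable {α β : ℝ}

theorem expDiffMeasure_succ_left (a b : ℕ) :
    expDiffMeasure α β (a + 1) b = expMeasure α ∗ expDiffMeasure α β a b := by
  rw [expDiffMeasure, Function.iterate_succ_apply']; rfl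

theorem expDiffMeasure_zero_succ (b : ℕ) :
    expDiffMeasure α β 0 (b + 1) = negExpMeasure β ∗ expDiffMeasure α β 0 b := by
  simp only [expDiffMeasure, Function.iterate_succ_apply', Function.iterate_zero, id]

theorem isProbabilityMeasure_expDiffMeasure (hα : 0 < α) (hβ : 0 < β) (a b : ℕ) :
    IsProbabilityMeasure (expDiffMeasure α β a b) := by
  have := isProbabilityMeasure_expMeasure hα
  have := isProbabilityMeasure_negExpMeasure hβ
  induction a with
  | zero =>
    induction b with
    | zero => exact inferInstanceAs (IsProbabilityMeasure (Measure.dirac (0 : ℝ)))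
    | succ b ih => rw [expDiffMeasure_zero_succ]; infer_instance
  | succ a ih => rw [expDiffMeasure_succ_left]; infer_instance

theorem charFun_expDiffMeasure (hα : 0 < α) (hβ : 0 < β) (a b : ℕ) (t : ℝ) :
    charFun (expDiffMeasure α β a b) t
      = (α / (α - t * Complex.I)) ^ a * (β / (β + t * Complex.I)) ^ b := by
  have := isProbabilityMeasure_expMeasure hα
  have := isProbabilityMeasure_negExpMeasure hβ
  have := isProbabilityMeasure_expDiffMeasure hα hβ
  induction a with
  | zero =>
    induction b with
    | zero => simp [expDiffMeasure, charFun_dirac]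
    | succ b ih =>
      rw [expDiffMeasure_zero_succ, charFun_conv, ih, charFun_negExpMeasure hβ]; ring
  | succ a ih => rw [expDiffMeasure_succ_left, charFun_conv, ih, charFun_expMeasure hα]; ring

/-- Memorylessness: of two competing exponential clocks of rates `α` and `β`, the second rings
first with probability `β / (α + β)`, and then a fresh exponential of rate `α` remains. On
characteristic functions this is the partial fraction decomposition. -/
theorem expDiffMeasure_succ_succ (hα : 0 < α) (hβ : 0 < β) (a b : ℕ) :
    expDiffMeasure α β (a + 1) (b + 1)
      = ENNReal.ofReal (β / (α + β)) • expDiffMeasure α β (a + 1) b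
        + ENNReal.ofReal (α / (α + β)) • expDiffMeasure α β a (b + 1) := by
  have := isProbabilityMeasure_expDiffMeasure hα hβ
  have hfin : ∀ (c : ℝ) (μ : Measure ℝ) [IsProbabilityMeasure μ],
      IsFiniteMeasure (ENNReal.ofReal c • μ) := fun c μ _ =>
    Measure.smul_finite μ ENNReal.ofReal_ne_top
  have := fun a b => hfin (β / (α + β)) (expDiffMeasure α β a b)
  have := fun a b => hfin (α / (α + β)) (expDiffMeasure α β a b)
  have hint : ∀ (t : ℝ) (μ : Measure ℝ) [IsFiniteMeasure μ],
      Integrable (fun x : ℝ => Complex.exp (t * x * Complex.I)) μ := by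
    intro t μ _
    refine Integrable.of_bound (by fun_prop) 1 (ae_of_all _ fun x => ?_)
    rw [← Complex.ofReal_mul, Complex.norm_exp_ofReal_mul_I]
  refine Measure.ext_of_charFun (funext fun t => ?_)
  rw [charFun_apply_real (μ := _ + _), integral_add_measure (hint _ _) (hint _ _),
    integral_smul_measure, integral_smul_measure, ← charFun_apply_real, ← charFun_apply_real,
    charFun_expDiffMeasure hα hβ, charFun_expDiffMeasure hα hβ, charFun_expDiffMeasure hα hβ,
    ENNReal.toReal_ofReal (by positivity), ENNReal.toReal_ofReal (by positivity),
    Complex.real_smul, Complex.real_smul]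
  have h1 := ofReal_sub_mul_I_ne_zero hα t
  have h2 := ofReal_add_mul_I_ne_zero hβ t
  have h3 : (α : ℂ) + β ≠ 0 := by exact_mod_cast (add_pos hα hβ).ne'
  have key : (α / (α - t * Complex.I)) * (β / (β + t * Complex.I))
      = (β / (α + β)) * (α / (α - t * Complex.I)) + (α / (α + β)) * (β / (β + t * Complex.I)) := by
    field_simp; ring
  push_cast
  rw [pow_succ, pow_succ]
  linear_combination ((α / (α - t * Complex.I)) ^ a * (β / (β + t * Complex.I)) ^ b) * key

theorem conv_Iic_zero {μ ν : Measure ℝ} [SFinite μ] [SFinite ν] (hμ : μ (Set.Iic 0) = 0)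
    (hν : ν (Set.Iio 0) = 0) : (μ ∗ ν) (Set.Iic 0) = 0 := by
  rw [Measure.conv, Measure.map_apply (by fun_prop) measurableSet_Iic]
  refine measure_mono_null (t := Set.Iic 0 ×ˢ Set.univ ∪ Set.univ ×ˢ Set.Iio 0) ?_ ?_
  · rintro ⟨x, y⟩ h
    simp only [Set.mem_preimage, Set.mem_Iic, Set.mem_union, Set.mem_prod, Set.mem_univ,
      Set.mem_Iio, and_true, true_and] at *
    by_contra! hc; linarith
  · rw [measure_union_null_iff, Measure.prod_prod, Measure.prod_prod, hμ, hν]; simp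

theorem conv_Ici_zero {μ ν : Measure ℝ} [SFinite μ] [SFinite ν] (hμ : μ (Set.Ici 0) = 0)
    (hν : ν (Set.Ioi 0) = 0) : (μ ∗ ν) (Set.Ici 0) = 0 := by
  rw [Measure.conv, Measure.map_apply (by fun_prop) measurableSet_Ici]
  refine measure_mono_null (t := Set.Ici 0 ×ˢ Set.univ ∪ Set.univ ×ˢ Set.Ioi 0) ?_ ?_
  · rintro ⟨x, y⟩ h
    simp only [Set.mem_preimage, Set.mem_Ici, Set.mem_union, Set.mem_prod, Set.mem_univ,
      Set.mem_Ioi, and_true, true_and] at *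
    by_contra! hc; linarith
  · rw [measure_union_null_iff, Measure.prod_prod, Measure.prod_prod, hμ, hν]; simp

theorem expDiffMeasure_succ_zero_Ioi (hα : 0 < α) (hβ : 0 < β) (a : ℕ) :
    (expDiffMeasure α β (a + 1) 0).real (Set.Ioi 0) = 1 := by
  have := isProbabilityMeasure_expMeasure hα
  have := isProbabilityMeasure_expDiffMeasure hα hβ
  have h : ∀ a, expDiffMeasure α β (a + 1) 0 (Set.Iic 0) = 0 := by
    intro a
    induction a with
    | zero =>
      rw [expDiffMeasure_succ_left]
      exact conv_Iic_zero (expMeasure_Iic_zero hα) (by simp [expDiffMeasure])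
    | succ a ih =>
      rw [expDiffMeasure_succ_left]
      exact conv_Iic_zero (expMeasure_Iic_zero hα) (measure_mono_null Set.Iio_subset_Iic_self ih)
  have h' := prob_compl_eq_one_iff (μ := expDiffMeasure α β (a + 1) 0)
    (measurableSet_Iic (a := (0 : ℝ))) |>.2 (h a)
  rw [Set.compl_Iic] at h'
  simp [measureReal_def, h']

theorem expDiffMeasure_zero_succ_Ioi (hα : 0 < α) (hβ : 0 < β) (b : ℕ) :
    (expDiffMeasure α β 0 (b + 1)).real (Set.Ioi 0) = 0 := by
  have := isProbabilityMeasure_negExpMeasure hβ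
  have := isProbabilityMeasure_expDiffMeasure hα hβ
  have h : ∀ b, expDiffMeasure α β 0 (b + 1) (Set.Ici 0) = 0 := by
    intro b
    induction b with
    | zero =>
      rw [expDiffMeasure_zero_succ]
      exact conv_Ici_zero (negExpMeasure_Ici_zero hβ) (by simp [expDiffMeasure])
    | succ b ih =>
      rw [expDiffMeasure_zero_succ]
      exact conv_Ici_zero (negExpMeasure_Ici_zero hβ)
        (measure_mono_null Set.Ioi_subset_Ici_self ih)
  simp [measureReal_def, measure_mono_null Set.Ioi_subset_Ici_self (h b)]

open Finset in
/-- The difference is positive exactly when, among the first `a + b - 1` rings of two competing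
Poisson clocks, at most `a - 1` belong to the first one; the count is binomial. -/
theorem expDiffMeasure_Ioi (hα : 0 < α) (hβ : 0 < β) (a b : ℕ) (hab : 1 ≤ a + b) :
    (expDiffMeasure α β a b).real (Set.Ioi 0)
      = ∑ i ∈ range a, ((a + b - 1).choose i : ℝ) * (α / (α + β)) ^ i
          * (β / (α + β)) ^ (a + b - 1 - i) := by
  have := isProbabilityMeasure_expDiffMeasure hα hβ
  -- Both sides satisfy `g (a + 1) (b + 1) = q * g a (b + 1) + p * g (a + 1) b`, where
  -- `q = α / (α + β)` and `p = β / (α + β)`.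
  induction a generalizing b with
  | zero =>
    obtain ⟨b, rfl⟩ : ∃ c, b = c + 1 := ⟨b - 1, by omega⟩
    rw [expDiffMeasure_zero_succ_Ioi hα hβ]; simp
  | succ a iha =>
    induction b with
    | zero =>
      have hs : α / (α + β) + β / (α + β) = 1 := by field_simp
      have h := add_pow (α / (α + β)) (β / (α + β)) a
      rw [hs, one_pow] at h
      rw [expDiffMeasure_succ_zero_Ioi hα hβ, h, show a + 1 + 0 - 1 = a by omega]
      exact sum_congr rfl fun i _ => by ring
    | succ b ihb =>
      have e : (expDiffMeasure α β (a + 1) (b + 1)).real (Set.Ioi 0)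
          = β / (α + β) * (expDiffMeasure α β (a + 1) b).real (Set.Ioi 0)
            + α / (α + β) * (expDiffMeasure α β a (b + 1)).real (Set.Ioi 0) := by
        rw [expDiffMeasure_succ_succ hα hβ, measureReal_def, Measure.add_apply,
          Measure.smul_apply, Measure.smul_apply, smul_eq_mul, smul_eq_mul,
          ENNReal.toReal_add (by finiteness) (by finiteness), ENNReal.toReal_mul,
          ENNReal.toReal_mul, ENNReal.toReal_ofReal (by positivity),
          ENNReal.toReal_ofReal (by positivity)]
        rfl
      rw [e, ihb (by omega), iha (b + 1) (by omega), show a + 1 + b - 1 = a + b by omega,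
        show a + (b + 1) - 1 = a + b by omega, show a + 1 + (b + 1) - 1 = a + b + 1 by omega,
        sum_range_succ', sum_range_succ']
      simp only [Nat.choose_succ_succ, Nat.choose_zero_right, Nat.cast_add, add_mul, mul_add,
        sum_add_distrib, mul_sum]
      have h1 : ∀ i ∈ range a, (β / (α + β)) * (((a + b).choose (i + 1) : ℝ)
            * (α / (α + β)) ^ (i + 1) * (β / (α + β)) ^ (a + b - (i + 1)))
          = ((a + b).choose (i + 1) : ℝ)
            * (α / (α + β)) ^ (i + 1) * (β / (α + β)) ^ (a + b + 1 - (i + 1)) := by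
        intro i hi
        rw [mem_range] at hi
        rw [show a + b + 1 - (i + 1) = a + b - (i + 1) + 1 by omega]; ring
      have h2 : ∀ i ∈ range a, (α / (α + β)) * (((a + b).choose i : ℝ)
            * (α / (α + β)) ^ i * (β / (α + β)) ^ (a + b - i))
          = ((a + b).choose i : ℝ)
            * (α / (α + β)) ^ (i + 1) * (β / (α + β)) ^ (a + b + 1 - (i + 1)) := by
        intro i hi
        rw [show a + b + 1 - (i + 1) = a + b - i by omega]; ring
      rw [sum_congr rfl h1, sum_congr rfl h2]
      simp only [Nat.sub_zero, pow_zero, pow_succ]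
      push_cast
      ring

end expDiff

/-! ### Law of the drop in gain -/

/-- Squaring removes the branch of the complex square root. -/
theorem integral_exp_neg_mul_sq_gaussianReal_sq {v : ℝ≥0} (hv : v ≠ 0) {c : ℂ} (hc : 0 ≤ c.re) :
    (∫ x : ℝ, Complex.exp (-c * (x : ℂ) ^ 2) ∂(gaussianReal 0 v)) ^ 2 = 1 / (1 + 2 * v * c) := by
  have hv0 : (0 : ℝ) < v := by positivity
  have hre : 0 < (c + ((1 / (2 * v) : ℝ) : ℂ)).re := by
    rw [Complex.add_re, Complex.ofReal_re]; positivity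
  have hne : c + ((1 / (2 * v) : ℝ) : ℂ) ≠ 0 := by
    intro h; rw [h] at hre; simp at hre
  have hd : ∀ x : ℝ, gaussianPDFReal 0 v x • Complex.exp (-c * (x : ℂ) ^ 2)
      = (((√(2 * Real.pi * v))⁻¹ : ℝ) : ℂ)
        * Complex.exp (-(c + ((1 / (2 * v) : ℝ) : ℂ)) * (x : ℂ) ^ 2) := by
    intro x
    rw [gaussianPDFReal, Complex.real_smul]
    push_cast
    rw [mul_assoc, ← Complex.exp_add]
    congr 2; ring
  rw [integral_gaussianReal_eq_integral_smul hv]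
  simp_rw [hd]
  rw [integral_const_mul, integral_gaussian_complex hre, mul_pow, ← Complex.ofReal_pow, inv_pow,
    Real.sq_sqrt (by positivity), one_div (2 : ℂ),
    show ((2 : ℂ)⁻¹) = (((2 : ℕ) : ℂ))⁻¹ by norm_num, Complex.cpow_nat_inv_pow _ two_ne_zero]
  have hv' : (v : ℂ) ≠ 0 := by exact_mod_cast hv0.ne'
  have hpi : (Real.pi : ℂ) ≠ 0 := by exact_mod_cast Real.pi_ne_zero
  have h2 : 1 + 2 * v * c = 2 * v * (c + ((1 / (2 * v) : ℝ) : ℂ)) := by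
    push_cast; field_simp; ring
  rw [h2]
  push_cast at hne ⊢
  field_simp

theorem integral_exp_sq_sub_sq_add_gaussianReal (a : ℝ≥0) (t y : ℝ) :
    ∫ x : ℝ, Complex.exp (t * (x ^ 2 - (x + y) ^ 2 : ℝ) * Complex.I) ∂(gaussianReal 0 a)
      = Complex.exp (-(2 * a * t ^ 2 + t * Complex.I) * (y : ℂ) ^ 2) := by
  have h : ∀ x : ℝ, Complex.exp (t * (x ^ 2 - (x + y) ^ 2 : ℝ) * Complex.I)
      = Complex.exp (-(t * Complex.I) * (y : ℂ) ^ 2)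
        * Complex.exp ((-2 * t * y : ℝ) * x * Complex.I) := by
    intro x
    rw [← Complex.exp_add]
    congr 1; push_cast; ring
  simp_rw [h]
  rw [integral_const_mul, ← charFun_apply_real, charFun_gaussianReal, ← Complex.exp_add]
  congr 1; push_cast; ring

/-- The drop in gain `|u|² - |u + v|²` of one link, with estimate `u` and estimation error `v`. -/
def gainDrop (x : ℂ × ℂ) : ℝ := Complex.normSq x.1 - Complex.normSq (x.1 + x.2)

theorem measurable_gainDrop : Measurable gainDrop := by
  unfold gainDrop
  exact (Complex.continuous_normSq.comp continuous_fst).sub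
    (Complex.continuous_normSq.comp (continuous_fst.add continuous_snd)) |>.measurable

instance isProbabilityMeasure_complexGaussian (v : ℝ≥0) :
    IsProbabilityMeasure (DeviceFailure.complexGaussian v) :=
  Measure.isProbabilityMeasure_map (by fun_prop)

/-- The integral over the real and imaginary parts of the estimate is a Gaussian characteristic
function, since the squares of the estimate cancel in the drop. What remains is a Gaussian integral
in each part of the error, and the product of these two equal integrals is rational in `t`. -/
theorem integral_exp_gainDrop (a : ℝ≥0) {b : ℝ≥0} (hb : b ≠ 0) (t : ℝ) :
    ∫ x, Complex.exp (t * gainDrop x * Complex.I)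
        ∂((DeviceFailure.complexGaussian a).prod (DeviceFailure.complexGaussian b))
      = 1 / (1 + b * (a * t ^ 2 + t * Complex.I)) := by
  have hmeas : Measurable fun p : ℝ × ℝ => (p.1 : ℂ) + (p.2 : ℂ) * Complex.I := by fun_prop
  have hexp : Measurable fun x => Complex.exp (t * gainDrop x * Complex.I) := by
    have := measurable_gainDrop
    fun_prop
  rw [DeviceFailure.complexGaussian, DeviceFailure.complexGaussian,
    Measure.map_prod_map _ _ hmeas hmeas,
    integral_map (hmeas.prodMap hmeas).aemeasurable hexp.aestronglyMeasurable]
  have hsplit : ∀ z : (ℝ × ℝ) × (ℝ × ℝ), Complex.exp (t * gainDrop (Prod.map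
        (fun p : ℝ × ℝ => (p.1 : ℂ) + (p.2 : ℂ) * Complex.I)
        (fun p : ℝ × ℝ => (p.1 : ℂ) + (p.2 : ℂ) * Complex.I) z) * Complex.I)
      = Complex.exp (t * (z.1.1 ^ 2 - (z.1.1 + z.2.1) ^ 2 : ℝ) * Complex.I)
        * Complex.exp (t * (z.1.2 ^ 2 - (z.1.2 + z.2.2) ^ 2 : ℝ) * Complex.I) := by
    intro z
    rw [← Complex.exp_add]
    congr 1
    have : gainDrop (Prod.map (fun p : ℝ × ℝ => (p.1 : ℂ) + (p.2 : ℂ) * Complex.I)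
        (fun p : ℝ × ℝ => (p.1 : ℂ) + (p.2 : ℂ) * Complex.I) z)
        = (z.1.1 ^ 2 - (z.1.1 + z.2.1) ^ 2) + (z.1.2 ^ 2 - (z.1.2 + z.2.2) ^ 2) := by
      simp [gainDrop, Complex.normSq_apply]; ring
    rw [this]; push_cast; ring
  simp_rw [hsplit]
  rw [integral_prod_symm]
  · have hinner : ∀ y : ℝ × ℝ, ∫ x : ℝ × ℝ,
        Complex.exp (t * (x.1 ^ 2 - (x.1 + y.1) ^ 2 : ℝ) * Complex.I)
          * Complex.exp (t * (x.2 ^ 2 - (x.2 + y.2) ^ 2 : ℝ) * Complex.I)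
          ∂((gaussianReal 0 (a / 2)).prod (gaussianReal 0 (a / 2)))
        = Complex.exp (-(2 * (a / 2 : ℝ≥0) * t ^ 2 + t * Complex.I) * (y.1 : ℂ) ^ 2)
          * Complex.exp (-(2 * (a / 2 : ℝ≥0) * t ^ 2 + t * Complex.I) * (y.2 : ℂ) ^ 2) := by
      intro y
      rw [integral_prod_mul
        (fun x : ℝ => Complex.exp (t * (x ^ 2 - (x + y.1) ^ 2 : ℝ) * Complex.I))
        (fun x : ℝ => Complex.exp (t * (x ^ 2 - (x + y.2) ^ 2 : ℝ) * Complex.I)),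
        integral_exp_sq_sub_sq_add_gaussianReal, integral_exp_sq_sub_sq_add_gaussianReal]
    simp_rw [hinner]
    rw [integral_prod_mul (μ := gaussianReal 0 (b / 2)) (ν := gaussianReal 0 (b / 2))
      (fun y : ℝ => Complex.exp (-(2 * (a / 2 : ℝ≥0) * t ^ 2 + t * Complex.I) * (y : ℂ) ^ 2))
      (fun y : ℝ => Complex.exp (-(2 * (a / 2 : ℝ≥0) * t ^ 2 + t * Complex.I) * (y : ℂ) ^ 2)),
      ← pow_two, integral_exp_neg_mul_sq_gaussianReal_sq (by positivity)]
    · congr 2; push_cast; ring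
    · have : (2 * ((a / 2 : ℝ≥0) : ℂ) * t ^ 2 + t * Complex.I).re
          = 2 * ((a / 2 : ℝ≥0) : ℝ) * t ^ 2 := by
        simp [← Complex.ofReal_pow]
      rw [this]; positivity
  · refine Integrable.of_bound (by fun_prop) 1 (ae_of_all _ fun z => ?_)
    rw [norm_mul, ← Complex.ofReal_mul, ← Complex.ofReal_mul, Complex.norm_exp_ofReal_mul_I,
      Complex.norm_exp_ofReal_mul_I, one_mul]

/-- Pairing up the two halves of an independent family gives independent pairs. -/
theorem map_prodMk_eq_pi_of_iIndepFun_sumElim {Ω ι E : Type*} [Fintype ι] [MeasurableSpace Ω]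
    [MeasurableSpace E] {P : Measure Ω} [IsProbabilityMeasure P] {X Y : ι → Ω → E}
    (hX : ∀ i, AEMeasurable (X i) P) (hY : ∀ i, AEMeasurable (Y i) P)
    (h : iIndepFun (Sum.elim X Y) P) :
    P.map (fun ω i => (X i ω, Y i ω)) = Measure.pi fun i => (P.map (X i)).prod (P.map (Y i)) := by
  have hXY : ∀ s : ι ⊕ ι, AEMeasurable (Sum.elim X Y s) P := by
    rintro (i | i)
    · exact hX i
    · exact hY i
  have := fun i => Measure.isProbabilityMeasure_map (hX i)
  have := fun i => Measure.isProbabilityMeasure_map (hY i)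
  have := fun s => Measure.isProbabilityMeasure_map (hXY s)
  have hpi := (iIndepFun_iff_map_fun_eq_pi_map hXY).1 h
  have hmeas : Measurable fun (z : ι ⊕ ι → E) (i : ι) => (z (.inl i), z (.inr i)) := by fun_prop
  have hjoint : AEMeasurable (fun ω s => Sum.elim X Y s ω) P := aemeasurable_pi_lambda _ hXY
  have hm : Measurable (fun (z : ι → E × E) (s : ι ⊕ ι) =>
      Sum.elim (fun i => (z i).1) (fun i => (z i).2) s) := by
    refine measurable_pi_lambda _ ?_
    rintro (i | i)
    · exact (measurable_pi_apply i).fst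
    · exact (measurable_pi_apply i).snd
  have hsplit : (Measure.pi fun i => (P.map (X i)).prod (P.map (Y i))).map
      (fun (z : ι → E × E) (s : ι ⊕ ι) => Sum.elim (fun i => (z i).1) (fun i => (z i).2) s)
      = Measure.pi fun s => P.map (Sum.elim X Y s) := by
    refine (Measure.pi_eq fun S hS => ?_).symm
    rw [Measure.map_apply hm (MeasurableSet.univ_pi hS)]
    have : (fun (z : ι → E × E) (s : ι ⊕ ι) =>
        Sum.elim (fun i => (z i).1) (fun i => (z i).2) s) ⁻¹' Set.univ.pi S
        = Set.univ.pi fun i => S (.inl i) ×ˢ S (.inr i) := by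
      ext z; simp [Set.mem_pi, Set.mem_prod, forall_and]
    rw [this, Measure.pi_pi, Fintype.prod_sum_type, ← Finset.prod_mul_distrib]
    simp [Measure.prod_prod]
  have e := congrArg (Measure.map fun (z : ι ⊕ ι → E) (i : ι) => (z (.inl i), z (.inr i)))
    (hpi.trans hsplit.symm)
  rw [AEMeasurable.map_map_of_aemeasurable hmeas.aemeasurable hjoint,
    Measure.map_map hmeas hm] at e
  exact e.trans Measure.map_id

/-- Up to sign, `1 / α` and `1 / β` are the two eigenvalues of the covariance matrix of `(u, u + v)`
times `diag(1, -1)`; the hypotheses prescribe the sum and the product of these eigenvalues. -/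
theorem map_sum_gainDrop_eq_expDiffMeasure {Ω : Type*} [MeasurableSpace Ω] {P : Measure Ω}
    [IsProbabilityMeasure P] {A : ℕ} {X Y : Fin A → Ω → ℂ} {a b : ℝ≥0} (hb : b ≠ 0)
    (hX : ∀ i, HasLaw (X i) (DeviceFailure.complexGaussian a) P)
    (hY : ∀ i, HasLaw (Y i) (DeviceFailure.complexGaussian b) P)
    (h : iIndepFun (Sum.elim X Y) P) {α β : ℝ} (hα : 0 < α) (hβ : 0 < β)
    (hsub : 1 / β - 1 / α = b) (hmul : 1 / (α * β) = a * b) :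
    P.map (fun ω => ∑ i, gainDrop (X i ω, Y i ω)) = expDiffMeasure α β A A := by
  have := isProbabilityMeasure_expDiffMeasure hα hβ A A
  have hg := measurable_gainDrop
  have hpair : AEMeasurable (fun ω i => (X i ω, Y i ω)) P :=
    aemeasurable_pi_lambda _ fun i => (hX i).aemeasurable.prodMk (hY i).aemeasurable
  have hS : Measurable fun z : Fin A → ℂ × ℂ => ∑ i, gainDrop (z i) := by fun_prop
  have hD : P.map (fun ω => ∑ i, gainDrop (X i ω, Y i ω))
      = (Measure.pi fun _ : Fin A => (DeviceFailure.complexGaussian a).prod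
          (DeviceFailure.complexGaussian b)).map fun z => ∑ i, gainDrop (z i) := by
    have e := map_prodMk_eq_pi_of_iIndepFun_sumElim (fun i => (hX i).aemeasurable)
      (fun i => (hY i).aemeasurable) h
    simp_rw [(hX _).map_eq, (hY _).map_eq] at e
    rw [← e, AEMeasurable.map_map_of_aemeasurable hS.aemeasurable hpair]
    rfl
  rw [hD]
  have := Measure.isProbabilityMeasure_map (μ := Measure.pi fun _ : Fin A =>
    (DeviceFailure.complexGaussian a).prod (DeviceFailure.complexGaussian b)) hS.aemeasurable
  refine Measure.ext_of_charFun (funext fun t => ?_)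
  rw [charFun_apply_real, integral_map hS.aemeasurable (by fun_prop),
    charFun_expDiffMeasure hα hβ]
  have hprod : ∀ z : Fin A → ℂ × ℂ,
      Complex.exp (t * ((∑ i, gainDrop (z i) : ℝ) : ℂ) * Complex.I)
        = ∏ i, Complex.exp (t * gainDrop (z i) * Complex.I) := by
    intro z
    rw [← Complex.exp_sum]
    push_cast
    rw [Finset.mul_sum, Finset.sum_mul]
  simp_rw [hprod]
  rw [integral_fintype_prod_eq_pow (fun x => Complex.exp (t * gainDrop x * Complex.I)),
    integral_exp_gainDrop a hb, Fintype.card_fin, ← mul_pow]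
  congr 1
  have h1 := ofReal_sub_mul_I_ne_zero hα t
  have h2 := ofReal_add_mul_I_ne_zero hβ t
  have hα' : (α : ℂ) ≠ 0 := by exact_mod_cast hα.ne'
  have hβ' : (β : ℂ) ≠ 0 := by exact_mod_cast hβ.ne'
  have hsub' : 1 / (β : ℂ) - 1 / α = b := by exact_mod_cast congrArg (Complex.ofReal) hsub
  have hmul' : 1 / ((α : ℂ) * β) = a * b := by exact_mod_cast congrArg (Complex.ofReal) hmul
  have e : (1 + b * (a * t ^ 2 + t * Complex.I) : ℂ)
      = (α - t * Complex.I) * (β + t * Complex.I) / (α * β) := by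
    rw [show (1 + b * (a * t ^ 2 + t * Complex.I) : ℂ) = 1 + (a * b) * t ^ 2 + b * (t * Complex.I)
      by ring, ← hmul', ← hsub']
    field_simp
    linear_combination ((t : ℂ) ^ 2) * Complex.I_sq
  rw [e]
  field_simp

/-! ### Binomial convolutions -/

open Finset in
/-- Convolution square of the central binomial coefficients. Writing `m + 1` as `i + j` under the sum
and using `(i + 1) C(2i + 2, i + 1) = 2 (2i + 1) C(2i, i)` gives the recursion of `4 ^ m`. -/
theorem sum_antidiagonal_centralBinom_mul (m : ℕ) :
    ∑ x ∈ antidiagonal m, x.1.centralBinom * x.2.centralBinom = 4 ^ m := by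
  induction m with
  | zero => simp
  | succ m ih =>
    have h1 : ∑ x ∈ antidiagonal (m + 1), x.1 * (x.1.centralBinom * x.2.centralBinom)
        = ∑ x ∈ antidiagonal m, 2 * (2 * x.1 + 1) * (x.1.centralBinom * x.2.centralBinom) := by
      rw [Finset.Nat.sum_antidiagonal_succ]
      simp only [zero_mul, zero_add]
      refine sum_congr rfl fun x _ => ?_
      rw [← mul_assoc, Nat.succ_mul_centralBinom_succ]; ring
    have h2 : ∑ x ∈ antidiagonal (m + 1), x.2 * (x.1.centralBinom * x.2.centralBinom)
        = ∑ x ∈ antidiagonal m, 2 * (2 * x.2 + 1) * (x.1.centralBinom * x.2.centralBinom) := by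
      rw [Finset.Nat.sum_antidiagonal_succ']
      simp only [zero_mul, zero_add]
      refine sum_congr rfl fun x _ => ?_
      rw [mul_left_comm, Nat.succ_mul_centralBinom_succ]; ring
    have h3 : (m + 1) * ∑ x ∈ antidiagonal (m + 1), x.1.centralBinom * x.2.centralBinom
        = (m + 1) * (4 * ∑ x ∈ antidiagonal m, x.1.centralBinom * x.2.centralBinom) := by
      calc _ = ∑ x ∈ antidiagonal (m + 1), x.1 * (x.1.centralBinom * x.2.centralBinom)
            + ∑ x ∈ antidiagonal (m + 1), x.2 * (x.1.centralBinom * x.2.centralBinom) := by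
            rw [← sum_add_distrib, mul_sum]
            refine sum_congr rfl fun x hx => ?_
            rw [← HasAntidiagonal.mem_antidiagonal.1 hx]; ring
        _ = _ := by
            rw [h1, h2, ← sum_add_distrib, mul_sum, mul_sum]
            refine sum_congr rfl fun x hx => ?_
            rw [← HasAntidiagonal.mem_antidiagonal.1 hx]; ring
    rw [Nat.eq_of_mul_eq_mul_left m.succ_pos h3, ih]; ring

open Finset in
/-- The convolution depends on `α` and `β` only through `α + β`. Both sides satisfy the same Pascal
recursion in `α` and in `β`, which reduces the identity to `α = β = 0`. -/
theorem sum_antidiagonal_choose_mul_choose (m α β : ℕ) :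
    ∑ x ∈ antidiagonal m, (2 * x.1 + α).choose x.1 * (2 * x.2 + β).choose x.2
      = ∑ i ∈ range (m + 1), (2 * m + α + β + 1).choose i := by
  induction m generalizing α β with
  | zero => simp
  | succ m ih =>
    have pascal : ∀ γ, ∑ i ∈ range (m + 1 + 1), (2 * (m + 1) + (γ + 1) + 1).choose i
        = ∑ i ∈ range (m + 1 + 1), (2 * (m + 1) + γ + 1).choose i
          + ∑ i ∈ range (m + 1), (2 * m + (γ + 2) + 1).choose i := by
      intro γ
      rw [sum_range_succ' _ (m + 1), sum_range_succ' _ (m + 1)]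
      rw [show 2 * (m + 1) + (γ + 1) + 1 = (2 * m + (γ + 2) + 1) + 1 by ring,
        show 2 * (m + 1) + γ + 1 = 2 * m + (γ + 2) + 1 by ring]
      simp only [Nat.choose_succ_succ, sum_add_distrib, Nat.choose_zero_right]
      ring
    have stepL : ∀ α β, ∑ x ∈ antidiagonal (m + 1),
          (2 * x.1 + (α + 1)).choose x.1 * (2 * x.2 + β).choose x.2
        = ∑ x ∈ antidiagonal (m + 1), (2 * x.1 + α).choose x.1 * (2 * x.2 + β).choose x.2
          + ∑ x ∈ antidiagonal m, (2 * x.1 + (α + 2)).choose x.1 * (2 * x.2 + β).choose x.2 := by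
      intro α β
      simp only [Finset.Nat.sum_antidiagonal_succ]
      rw [add_assoc, ← sum_add_distrib]
      congr 1
      · simp
      refine sum_congr rfl fun x _ => ?_
      rw [show 2 * (x.1 + 1) + (α + 1) = (2 * x.1 + (α + 2)) + 1 by ring,
        show 2 * (x.1 + 1) + α = 2 * x.1 + (α + 2) by ring, Nat.choose_succ_succ]
      ring
    have stepR : ∀ β, ∑ x ∈ antidiagonal (m + 1),
          (2 * x.1 + 0).choose x.1 * (2 * x.2 + (β + 1)).choose x.2
        = ∑ x ∈ antidiagonal (m + 1), (2 * x.1 + 0).choose x.1 * (2 * x.2 + β).choose x.2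
          + ∑ x ∈ antidiagonal m, (2 * x.1 + 0).choose x.1 * (2 * x.2 + (β + 2)).choose x.2 := by
      intro β
      simp only [Finset.Nat.sum_antidiagonal_succ']
      rw [add_assoc, ← sum_add_distrib]
      congr 1
      · simp
      refine sum_congr rfl fun x _ => ?_
      rw [show 2 * (x.2 + 1) + (β + 1) = (2 * x.2 + (β + 2)) + 1 by ring,
        show 2 * (x.2 + 1) + β = 2 * x.2 + (β + 2) by ring, Nat.choose_succ_succ]
      ring
    induction α with
    | zero =>
      induction β with
      | zero =>
        have := sum_antidiagonal_centralBinom_mul (m + 1)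
        simp only [Nat.centralBinom] at this
        simpa [Nat.sum_range_choose_halfway] using this
      | succ β ihβ =>
        rw [stepR, ihβ, ih]
        have := pascal β
        simp only [add_zero] at *
        rw [this]
    | succ α ihα =>
      rw [stepL, ihα, ih]
      have := pascal (α + β)
      rw [show 2 * (m + 1) + (α + 1) + β + 1 = 2 * (m + 1) + (α + β + 1) + 1 by ring, this]
      congr 2 <;> (ext i; congr 1; ring)

open Finset in
/-- Summation by parts against the partial sums of `c`, in bihomogeneous form. -/
theorem sub_mul_sum_partialSum {R : Type*} [CommRing R] (c : ℕ → R) (p q : R) (N k : ℕ)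
    (hk : k ≤ N) :
    (q - p) * ∑ m ∈ range (k + 1), (∑ i ∈ range (m + 1), c i) * p ^ m * q ^ (N - m)
      = ∑ i ∈ range (k + 1), c i * p ^ i * q ^ (N + 1 - i)
        - (∑ i ∈ range (k + 1), c i) * p ^ (k + 1) * q ^ (N - k) := by
  induction k with
  | zero => simp; ring
  | succ k ih =>
    rw [sum_range_succ, mul_add, ih (by omega), sum_range_succ _ (k + 1),
      sum_range_succ _ (k + 1), show N - k = N - (k + 1) + 1 by omega,
      show N + 1 - (k + 1) = N - (k + 1) + 1 by omega]
    ring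

/-- The monomial `C(n + j - k, j) C(n + k - j, k) p ^ (j + k) q ^ (2n - j - k)` attached to the
lattice point `x = (j, k)` of the square `{0, …, n}²`, where no subtraction truncates. Its sums along
antidiagonals are partial sums of binomial coefficients; its sums along diagonals are Legendre
functions. -/
def pairTerm (n : ℕ) (p q : ℝ) (x : ℕ × ℕ) : ℝ :=
  ((n + x.1 - x.2).choose x.1 : ℝ) * ((n + x.2 - x.1).choose x.2 : ℝ)
    * p ^ (x.1 + x.2) * q ^ (2 * n - (x.1 + x.2))

theorem pairTerm_swap (n : ℕ) (p q : ℝ) (x : ℕ × ℕ) :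
    pairTerm n p q x.swap = pairTerm n p q x := by
  simp only [pairTerm, Prod.fst_swap, Prod.snd_swap, add_comm x.2 x.1]
  ring

theorem pairTerm_reflect (n : ℕ) (p q : ℝ) {j k : ℕ} (hj : j ≤ n) (hk : k ≤ n) :
    pairTerm n p q (n - j, n - k) = pairTerm n q p (j, k) := by
  have h1 : (n + (n - j) - (n - k)).choose (n - j) = (n + k - j).choose k := by
    rw [show n + (n - j) - (n - k) = n + k - j by omega]
    exact Nat.choose_symm_of_eq_add (by omega)
  have h2 : (n + (n - k) - (n - j)).choose (n - k) = (n + j - k).choose j := by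
    rw [show n + (n - k) - (n - j) = n + j - k by omega]
    exact Nat.choose_symm_of_eq_add (by omega)
  simp only [pairTerm, h1, h2]
  rw [show n - j + (n - k) = 2 * n - (j + k) by omega,
    show 2 * n - (2 * n - (j + k)) = j + k by omega]
  ring

open Finset in
theorem sum_antidiagonal_pairTerm {n m : ℕ} (hm : m ≤ n) (p q : ℝ) :
    ∑ x ∈ antidiagonal m, pairTerm n p q x
      = (∑ i ∈ range (m + 1), ((2 * n + 1).choose i : ℝ)) * p ^ m * q ^ (2 * n - m) := by
  have h := sum_antidiagonal_choose_mul_choose m (n - m) (n - m)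
  rw [show 2 * m + (n - m) + (n - m) + 1 = 2 * n + 1 by omega] at h
  have h' := congrArg (Nat.cast : ℕ → ℝ) h
  push_cast at h'
  rw [← h', sum_mul, sum_mul]
  refine sum_congr rfl fun x hx => ?_
  have hx' := HasAntidiagonal.mem_antidiagonal.1 hx
  rw [pairTerm, hx', show n + x.1 - x.2 = 2 * x.1 + (n - m) by omega,
    show n + x.2 - x.1 = 2 * x.2 + (n - m) by omega]

open Finset in
theorem sum_pairTerm_low (n : ℕ) (p q : ℝ) :
    ∑ x ∈ range (n + 1) ×ˢ range (n + 1) with x.1 + x.2 ≤ n, pairTerm n p q x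
      = ∑ m ∈ range (n + 1),
        (∑ i ∈ range (m + 1), ((2 * n + 1).choose i : ℝ)) * p ^ m * q ^ (2 * n - m) := by
  rw [← sum_fiberwise_of_maps_to (t := range (n + 1)) (g := fun x : ℕ × ℕ => x.1 + x.2)
    (by intro x hx; simp only [mem_filter, mem_range] at *; omega)]
  refine sum_congr rfl fun m hm => ?_
  rw [mem_range] at hm
  rw [← sum_antidiagonal_pairTerm (by omega)]
  refine sum_congr ?_ fun _ _ => rfl
  ext x
  simp only [mem_filter, mem_product, mem_range, HasAntidiagonal.mem_antidiagonal]
  omega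

open Finset in
/-- Reflection in the centre of the square exchanges `p` and `q`. -/
theorem sum_pairTerm_high (n : ℕ) (p q : ℝ) :
    ∑ x ∈ range (n + 1) ×ˢ range (n + 1) with n ≤ x.1 + x.2, pairTerm n p q x
      = ∑ x ∈ range (n + 1) ×ˢ range (n + 1) with x.1 + x.2 ≤ n, pairTerm n q p x := by
  refine sum_nbij' (fun x => (n - x.1, n - x.2)) (fun x => (n - x.1, n - x.2)) ?_ ?_ ?_ ?_ ?_
  · intro x hx; simp only [mem_filter, mem_product, mem_range] at *; omega
  · intro x hx; simp only [mem_filter, mem_product, mem_range] at *; omega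
  · intro x hx; simp only [mem_filter, mem_product, mem_range] at hx; ext <;> simp <;> omega
  · intro x hx; simp only [mem_filter, mem_product, mem_range] at hx; ext <;> simp <;> omega
  · intro x hx
    simp only [mem_filter, mem_product, mem_range] at hx
    exact (pairTerm_reflect n q p (by omega) (by omega)).symm

open Finset in
/-- The square is summed along antidiagonals: below the main one by the convolution identity, above it
by reflection. Multiplication by `q - p` then telescopes to the two halves of `(p + q) ^ (2n + 1)`. -/
theorem sub_mul_sum_pairTerm (n : ℕ) (p q : ℝ) :
    (q - p) * ∑ x ∈ range (n + 1) ×ˢ range (n + 1), pairTerm n p q x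
      = ∑ i ∈ range (n + 1), ((2 * n + 1).choose i : ℝ) * p ^ i * q ^ (2 * n + 1 - i)
        - ∑ i ∈ range (n + 1), ((2 * n + 1).choose i : ℝ) * q ^ i * p ^ (2 * n + 1 - i) := by
  -- The main antidiagonal lies in both halves, so it is subtracted once.
  have hsplit : ∑ x ∈ range (n + 1) ×ˢ range (n + 1), pairTerm n p q x
      = ∑ x ∈ range (n + 1) ×ˢ range (n + 1) with x.1 + x.2 ≤ n, pairTerm n p q x
        + ∑ x ∈ range (n + 1) ×ˢ range (n + 1) with n ≤ x.1 + x.2, pairTerm n p q x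
        - ∑ x ∈ antidiagonal n, pairTerm n p q x := by
    rw [← sum_filter_add_sum_filter_not _ (fun x : ℕ × ℕ => x.1 + x.2 ≤ n),
      ← sum_filter_add_sum_filter_not (filter (fun x : ℕ × ℕ => n ≤ x.1 + x.2) _)
        (fun x : ℕ × ℕ => x.1 + x.2 ≤ n), filter_filter, filter_filter]
    have e1 : filter (fun x : ℕ × ℕ => n ≤ x.1 + x.2 ∧ x.1 + x.2 ≤ n)
        (range (n + 1) ×ˢ range (n + 1)) = antidiagonal n := by
      ext x; simp only [mem_filter, mem_product, mem_range, HasAntidiagonal.mem_antidiagonal]; omega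
    have e2 : filter (fun x : ℕ × ℕ => n ≤ x.1 + x.2 ∧ ¬ x.1 + x.2 ≤ n)
        (range (n + 1) ×ˢ range (n + 1)) = filter (fun x : ℕ × ℕ => ¬ x.1 + x.2 ≤ n)
        (range (n + 1) ×ˢ range (n + 1)) := by
      ext x; simp only [mem_filter, mem_product, mem_range]; omega
    rw [e1, e2]; ring
  have h1 := sub_mul_sum_partialSum (fun i => ((2 * n + 1).choose i : ℝ)) p q (2 * n) n (by omega)
  have h2 := sub_mul_sum_partialSum (fun i => ((2 * n + 1).choose i : ℝ)) q p (2 * n) n (by omega)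
  rw [hsplit, sum_pairTerm_high, sum_pairTerm_low, sum_pairTerm_low,
    sum_antidiagonal_pairTerm le_rfl]
  rw [show 2 * n - n = n by omega] at *
  linear_combination h1 - h2

open Finset in
theorem sum_pairTerm_eq_diagonals (n : ℕ) (p q : ℝ) :
    ∑ x ∈ range (n + 1) ×ˢ range (n + 1), pairTerm n p q x
      = ∑ k ∈ range (n + 1), pairTerm n p q (k, k)
        + 2 * ∑ a ∈ Icc 1 n, ∑ k ∈ range (n - a + 1), pairTerm n p q (k + a, k) := by
  have hlt : ∑ x ∈ range (n + 1) ×ˢ range (n + 1) with x.1 < x.2, pairTerm n p q x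
      = ∑ x ∈ range (n + 1) ×ˢ range (n + 1) with x.2 < x.1, pairTerm n p q x := by
    refine sum_nbij' Prod.swap Prod.swap ?_ ?_ (by simp) (by simp) ?_
    · intro x hx; simp only [mem_filter, mem_product, Prod.fst_swap, Prod.snd_swap] at *; tauto
    · intro x hx; simp only [mem_filter, mem_product, Prod.fst_swap, Prod.snd_swap] at *; tauto
    · intro x _; exact (pairTerm_swap n p q x).symm
  have heq : ∑ x ∈ range (n + 1) ×ˢ range (n + 1) with x.1 = x.2, pairTerm n p q x
      = ∑ k ∈ range (n + 1), pairTerm n p q (k, k) := by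
    refine sum_nbij' Prod.fst (fun k => (k, k)) ?_ ?_ ?_ ?_ ?_
    · intro x hx; simp only [mem_filter, mem_product] at *; tauto
    · intro x hx; simp_all
    · rintro ⟨a, b⟩ hx; simp_all
    · simp
    · rintro ⟨a, b⟩ hx; simp_all
  have hgt : ∑ x ∈ range (n + 1) ×ˢ range (n + 1) with x.2 < x.1, pairTerm n p q x
      = ∑ a ∈ Icc 1 n, ∑ k ∈ range (n - a + 1), pairTerm n p q (k + a, k) := by
    rw [← sum_fiberwise_of_maps_to (t := Icc 1 n) (g := fun x : ℕ × ℕ => x.1 - x.2)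
      (by intro x hx; simp only [mem_filter, mem_product, mem_range, mem_Icc] at *; omega)]
    refine sum_congr rfl fun a ha => ?_
    rw [mem_Icc] at ha
    refine sum_nbij' Prod.snd (fun k => (k + a, k)) ?_ ?_ ?_ ?_ ?_
    · intro x hx; simp only [mem_filter, mem_product, mem_range] at *; omega
    · intro x hx; simp only [mem_filter, mem_product, mem_range] at *; omega
    · rintro ⟨i, j⟩ hx
      simp only [mem_filter, mem_product, mem_range] at hx
      ext <;> simp; omega
    · simp
    · rintro ⟨i, j⟩ hx
      simp only [mem_filter, mem_product, mem_range] at hx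
      congr 2; omega
  rw [← heq, ← hgt, ← sum_filter_add_sum_filter_not _ (fun x : ℕ × ℕ => x.1 = x.2), two_mul]
  congr 1
  nth_rewrite 2 [← hlt]
  rw [← sum_filter_add_sum_filter_not (filter (fun x : ℕ × ℕ => ¬ x.1 = x.2) _)
        (fun x : ℕ × ℕ => x.2 < x.1), filter_filter, filter_filter]
  congr 1 <;> (refine sum_congr ?_ fun _ _ => rfl; ext x
               simp only [mem_filter, mem_product, mem_range]; omega)

open Finset in
theorem sum_range_choose_add_swap {p q : ℝ} (hpq : p + q = 1) (n : ℕ) :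
    ∑ i ∈ range (n + 1), ((2 * n + 1).choose i : ℝ) * p ^ i * q ^ (2 * n + 1 - i)
      + ∑ i ∈ range (n + 1), ((2 * n + 1).choose i : ℝ) * q ^ i * p ^ (2 * n + 1 - i) = 1 := by
  have h := add_pow p q (2 * n + 1)
  rw [hpq, one_pow, show 2 * n + 1 + 1 = (n + 1) + (n + 1) by ring, sum_range_add] at h
  rw [h]
  congr 1
  · exact sum_congr rfl fun i _ => by ring
  · rw [← sum_range_reflect]
    refine sum_congr rfl fun i hi => ?_
    rw [mem_range] at hi
    rw [show 2 * n + 1 - (n + 1 - 1 - i) = n + 1 + i by omega,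
      show 2 * n + 1 - (n + 1 + i) = n + 1 - 1 - i by omega,
      Nat.choose_symm_of_eq_add (show 2 * n + 1 = (n + 1 - 1 - i) + (n + 1 + i) by omega)]
    ring

/-! ### Legendre functions and the binomial tail -/

open Finset in
theorem ordinaryHypergeometric_neg_nat_eq_sum (n : ℕ) (b c x : ℝ) :
    ordinaryHypergeometric (-(n : ℝ)) b c x
      = ∑ k ∈ range (n + 1), ((k.factorial : ℝ)⁻¹ * (ascPochhammer ℝ k).eval (-(n : ℝ))
          * (ascPochhammer ℝ k).eval b * ((ascPochhammer ℝ k).eval c)⁻¹) * x ^ k := by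
  rw [ordinaryHypergeometric_eq_tsum]
  refine (tsum_eq_sum (s := range (n + 1)) fun k hk => ?_).trans ?_
  · rw [mem_range] at hk
    simp [(ascPochhammer_eval_eq_zero_iff k (-(n : ℝ))).2 ⟨n, by omega, by simp⟩]
  · simp

theorem ascPochhammer_eval_natCast_add_one (a k : ℕ) :
    (ascPochhammer ℝ k).eval ((a : ℝ) + 1) = ((a + k).factorial : ℝ) / (a.factorial : ℝ) := by
  have h : (ascPochhammer ℝ k).eval ((a + 1 : ℕ) : ℝ) = ((a + 1).ascFactorial k : ℝ) := by
    rw [← ascPochhammer_nat_eq_ascFactorial, ascPochhammer_eval_cast]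
  push_cast at h
  rw [h, ← Nat.factorial_mul_ascFactorial a k]
  push_cast
  field_simp

open Finset in
/-- The normalization by `C(n, a)` turns the coefficients into products of binomial coefficients. -/
theorem choose_mul_hypergeometric_eq_sum {n a : ℕ} (ha : a ≤ n) (w : ℝ) :
    (n.choose a : ℝ) * ordinaryHypergeometric (-(n : ℝ)) ((n : ℝ) + 1) ((a : ℝ) + 1) (-w)
      = ∑ k ∈ range (n + 1), (n.choose k : ℝ) * ((n + k).choose (n - a) : ℝ) * w ^ k := by
  rw [ordinaryHypergeometric_neg_nat_eq_sum, mul_sum]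
  refine sum_congr rfl fun k hk => ?_
  have hk' : k ≤ n := by rw [mem_range] at hk; omega
  rw [ascPochhammer_eval_natCast_add_one, ascPochhammer_eval_natCast_add_one,
    ascPochhammer_eval_neg_eq_descPochhammer, descPochhammer_eval_eq_descFactorial,
    Nat.cast_choose ℝ ha, Nat.cast_choose ℝ hk', Nat.cast_choose ℝ (show n - a ≤ n + k by omega),
    show n + k - (n - a) = a + k by omega, neg_pow w]
  have h1 : (n.descFactorial k : ℝ) = n.factorial / (n - k).factorial := by
    rw [eq_div_iff (by positivity), mul_comm]
    exact_mod_cast Nat.factorial_mul_descFactorial hk'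
  have h2 : ((-1 : ℝ) ^ k) * (-1) ^ k = 1 := by rw [← mul_pow]; simp
  rw [h1]
  field_simp
  linear_combination w ^ k * h2

open Finset in
/-- A polynomial form of Pfaff's transformation; comparing coefficients, it is the Vandermonde
identity. -/
theorem sum_choose_mul_choose_mul_pow_eq {n a : ℕ} (w : ℝ) :
    ∑ k ∈ range (n + 1), (n.choose k : ℝ) * ((n + k).choose (n - a) : ℝ) * w ^ k
      = ∑ j ∈ range (n - a + 1), (n.choose j : ℝ) * (n.choose (n - a - j) : ℝ)
          * w ^ j * (w + 1) ^ (n - j) := by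
  have hexp : ∀ j ∈ range (n - a + 1), (n.choose j : ℝ) * (n.choose (n - a - j) : ℝ)
        * w ^ j * (w + 1) ^ (n - j)
      = ∑ k ∈ range (n + 1),
        (n.choose k : ℝ) * ((k.choose j : ℝ) * (n.choose (n - a - j) : ℝ)) * w ^ k := by
    intro j hj
    rw [mem_range] at hj
    rw [← sum_subset (s₁ := Ico j (n + 1)) (by intro x; simp)
      (by
        intro k hk hk'
        simp only [mem_range, mem_Ico, not_and, not_lt] at hk hk'
        rw [Nat.choose_eq_zero_of_lt (show k < j by omega)]; simp),
      sum_Ico_eq_sum_range, show n + 1 - j = n - j + 1 by omega, add_pow, mul_sum]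
    refine sum_congr rfl fun i hi => ?_
    rw [mem_range] at hi
    have h : (n.choose (j + i) : ℝ) * ((j + i).choose j : ℝ)
        = (n.choose j : ℝ) * ((n - j).choose i : ℝ) := by
      have := Nat.choose_mul (n := n) (k := j + i) (s := j) (by omega)
      rw [show j + i - j = i by omega] at this
      exact_mod_cast this
    rw [one_pow, pow_add]
    linear_combination (-(n.choose (n - a - j) : ℝ) * w ^ j * w ^ i) * h
  rw [sum_congr rfl hexp, sum_comm]
  refine sum_congr rfl fun k _ => ?_
  rw [← sum_mul, ← mul_sum]
  congr 2
  rw [add_comm n k, Nat.add_choose_eq, Finset.Nat.sum_antidiagonal_eq_sum_range_succ_mk]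
  push_cast
  rfl

open Finset in
/-- In terms of `t`, with `x = (t + t⁻¹) / 2`, the Legendre function `P_n^{-a}(x)`, scaled by
`t ^ (n + 1)`, is a polynomial in `(1 - t) / 2` and `(1 + t) / 2`. -/
theorem factorial_mul_legendreP {n a : ℕ} (ha : a ≤ n) {t : ℝ} (ht0 : 0 < t) (ht1 : t < 1) :
    ((n + a).factorial : ℝ) / (n.factorial : ℝ) * t ^ (n + 1)
        * DeviceFailure.legendreP n a ((1 + t ^ 2) / (2 * t))
      = t * ∑ k ∈ range (n - a + 1), pairTerm n ((1 - t) / 2) ((1 + t) / 2) (k + a, k) := by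
  obtain ⟨p, hp⟩ : ∃ p, p = (1 - t) / 2 := ⟨_, rfl⟩
  obtain ⟨q, hq⟩ : ∃ q, q = (1 + t) / 2 := ⟨_, rfl⟩
  have hp0 : 0 < p := by rw [hp]; linarith
  have hq0 : 0 < q := by rw [hq]; linarith
  have hw : (1 - (1 + t ^ 2) / (2 * t)) / 2 = -(p ^ 2 / t) := by
    rw [hp]; field_simp; ring
  have hw1 : p ^ 2 / t + 1 = q ^ 2 / t := by
    rw [hp, hq]; field_simp; ring
  have hz : ((1 + t ^ 2) / (2 * t) - 1) / ((1 + t ^ 2) / (2 * t) + 1) = (p / q) ^ 2 := by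
    rw [hp, hq]; field_simp; ring
  have hza : ((p / q) ^ 2) ^ ((a : ℝ) / 2) = (p / q) ^ a := by
    rw [← Real.rpow_natCast (p / q) 2, ← Real.rpow_mul (by positivity), ← Real.rpow_natCast]
    congr 1; push_cast; ring
  have hF := choose_mul_hypergeometric_eq_sum ha (p ^ 2 / t)
  rw [sum_choose_mul_choose_mul_pow_eq, hw1] at hF
  have hC : (n.choose a : ℝ) ≠ 0 := by exact_mod_cast (Nat.choose_pos ha).ne'
  rw [← hp, ← hq, DeviceFailure.legendreP, hz, hza, hw, (eq_div_iff hC).2 ((mul_comm _ _).trans hF),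
    sum_div, mul_sum, mul_sum, mul_sum]
  refine sum_congr rfl fun k hk => ?_
  rw [mem_range] at hk
  have hc : ((n + a).factorial : ℝ) / n.factorial / a.factorial
        * ((n.choose k : ℝ) * (n.choose (n - a - k) : ℝ)) / n.choose a
      = ((n + a).choose (k + a) : ℝ) * ((n - a).choose k : ℝ) := by
    rw [Nat.cast_choose ℝ ha, Nat.cast_choose ℝ (show k ≤ n by omega),
      Nat.cast_choose ℝ (show n - a - k ≤ n by omega),
      Nat.cast_choose ℝ (show k + a ≤ n + a by omega),
      Nat.cast_choose ℝ (show k ≤ n - a by omega),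
      show n - (n - a - k) = k + a by omega, show n + a - (k + a) = n - k by omega]
    field_simp
  rw [pairTerm]
  dsimp only
  rw [show n + (k + a) - k = n + a by omega, show n + k - (k + a) = n - a by omega, ← hc]
  obtain ⟨m, rfl⟩ : ∃ m, n = m + k + a := ⟨n - a - k, by omega⟩
  rw [show m + k + a - k = m + a by omega,
    show 2 * (m + k + a) - (k + a + k) = 2 * m + a by omega]
  have hpow : t ^ (m + k + a + 1) * ((p / q) ^ a * ((p ^ 2 / t) ^ k * (q ^ 2 / t) ^ (m + a)))
      = t * (p ^ (k + a + k) * q ^ (2 * m + a)) := by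
    rw [div_pow, div_pow, div_pow]
    field_simp
    ring
  linear_combination (((m + k + a + a).factorial : ℝ) / (m + k + a).factorial / a.factorial
        * (((m + k + a).choose k : ℝ) * ((m + k + a).choose (m + k + a - a - k) : ℝ))
        / (m + k + a).choose a) * hpow

theorem pairTerm_nonneg (n : ℕ) {p q : ℝ} (hp : 0 ≤ p) (hq : 0 ≤ q) (x : ℕ × ℕ) :
    0 ≤ pairTerm n p q x := by
  unfold pairTerm; positivity

theorem legendreP_nonneg {n a : ℕ} (ha : a ≤ n) {t : ℝ} (ht0 : 0 < t) (ht1 : t < 1) :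
    0 ≤ DeviceFailure.legendreP n a ((1 + t ^ 2) / (2 * t)) := by
  have h := factorial_mul_legendreP ha ht0 ht1
  refine nonneg_of_mul_nonneg_right (b := DeviceFailure.legendreP n a ((1 + t ^ 2) / (2 * t)))
    (a := ((n + a).factorial : ℝ) / (n.factorial : ℝ) * t ^ (n + 1)) ?_ (by positivity)
  rw [h]
  exact mul_nonneg ht0.le (Finset.sum_nonneg fun k _ =>
    pairTerm_nonneg n (by linarith) (by linarith) _)

open Finset in
/-- With `p = (1 - t) / 2` and `q = (1 + t) / 2`, the left side `G` satisfies `1 - 2 G = t * S`, where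
`S` is the sum of `pairTerm` over the square; its diagonals are the Legendre terms. -/
theorem binomial_tail_eq_legendreP (n : ℕ) {t : ℝ} (ht0 : 0 < t) (ht1 : t < 1) :
    ∑ i ∈ range (n + 1), ((2 * n + 1).choose i : ℝ) * ((1 + t) / 2) ^ i
        * ((1 - t) / 2) ^ (2 * n + 1 - i)
      = 1 / 2 - 1 / 2 * t ^ (n + 1) * |DeviceFailure.legendreP n 0 ((1 + t ^ 2) / (2 * t))|
        - ∑ a ∈ Icc 1 n, ((n + a).factorial : ℝ) / (n.factorial : ℝ) * t ^ (n + 1)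
          * |DeviceFailure.legendreP n a ((1 + t ^ 2) / (2 * t))| := by
  have h0 := factorial_mul_legendreP (Nat.zero_le n) ht0 ht1
  have ha : ∀ a ∈ Icc 1 n, ((n + a).factorial : ℝ) / (n.factorial : ℝ) * t ^ (n + 1)
          * |DeviceFailure.legendreP n a ((1 + t ^ 2) / (2 * t))|
      = t * ∑ k ∈ range (n - a + 1), pairTerm n ((1 - t) / 2) ((1 + t) / 2) (k + a, k) := by
    intro a ha
    rw [mem_Icc] at ha
    rw [abs_of_nonneg (legendreP_nonneg ha.2 ht0 ht1), factorial_mul_legendreP ha.2 ht0 ht1]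
  rw [sum_congr rfl ha, ← mul_sum, abs_of_nonneg (legendreP_nonneg (Nat.zero_le n) ht0 ht1)]
  simp only [add_zero, Nat.sub_zero] at h0
  rw [div_self (by positivity), one_mul] at h0
  have h1 := sub_mul_sum_pairTerm n ((1 - t) / 2) ((1 + t) / 2)
  have h2 := sum_range_choose_add_swap (p := (1 - t) / 2) (q := (1 + t) / 2) (by ring) n
  rw [sum_pairTerm_eq_diagonals] at h1
  linear_combination (1 / 2) * h2 + (1 / 2) * h1 + (1 / 2) * h0

/-! ### Device failure -/

theorem beamformingSNR_eq_of_const {A : ℕ} {ρ : Fin A → ℝ} {ρ₀ : ℝ} (hρ : ∀ a, ρ a = ρ₀)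
    (g : Fin A → ℂ) :
    DeviceFailure.beamformingSNR ρ g = ρ₀ * ∑ a, Complex.normSq (g a) := by
  rw [DeviceFailure.beamformingSNR, DeviceFailure.snrMatrix, dotProduct, Complex.re_sum,
    Finset.mul_sum]
  refine Finset.sum_congr rfl fun a _ => ?_
  rw [Matrix.mulVec_diagonal, hρ, Pi.star_apply, mul_left_comm, Complex.star_def, mul_comm _ (g a),
    Complex.mul_conj, ← Complex.ofReal_mul, Complex.ofReal_re]

theorem rate_lt_rate_iff {A : ℕ} {W : ℝ} (hW : 0 < W) {ρ : Fin A → ℝ} {ρ₀ : ℝ} (hρ₀ : 0 < ρ₀)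
    (hρ : ∀ a, ρ a = ρ₀) (g g' : Fin A → ℂ) :
    DeviceFailure.rate W ρ g < DeviceFailure.rate W ρ g'
      ↔ ∑ a, Complex.normSq (g a) < ∑ a, Complex.normSq (g' a) := by
  have hpos : ∀ g : Fin A → ℂ, 0 < 1 + ρ₀ * ∑ a, Complex.normSq (g a) := fun g => by
    have := Finset.sum_nonneg fun a (_ : a ∈ Finset.univ) => Complex.normSq_nonneg (g a)
    positivity
  rw [DeviceFailure.rate, DeviceFailure.rate, beamformingSNR_eq_of_const hρ,
    beamformingSNR_eq_of_const hρ, mul_lt_mul_iff_right₀ hW,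
    Real.logb_lt_logb_iff one_lt_two (hpos g) (hpos g'), add_lt_add_iff_left,
    mul_lt_mul_iff_right₀ hρ₀]

end DeviceFailure

theorem mainTheorem3 {Ω : Type*} [MeasurableSpace Ω] (P : Measure Ω) [IsProbabilityMeasure P]
    (A : ℕ) (hA : 1 < A)
    (W : ℝ) (hW : 0 < W)
    (ρ : Fin A → ℝ) (ρ₀ : ℝ) (hρ₀ : 0 < ρ₀) (hρ : ∀ a, ρ a = ρ₀)
    (σE : ℝ) (hσ0 : 0 < σE) (hσ1 : σE < 1)
    (hHat hTilde h : Fin A → Ω → ℂ)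
    (hHat_law : ∀ a, HasLaw (hHat a) (DeviceFailure.complexGaussian (1 - σE ^ 2).toNNReal) P)
    (hTilde_law : ∀ a, HasLaw (hTilde a) (DeviceFailure.complexGaussian (σE ^ 2).toNNReal) P)
    (hindep : iIndepFun (Sum.elim hHat hTilde) P)
    (h_eq : ∀ a ω, h a ω = hHat a ω + hTilde a ω) :
    P.real {ω | DeviceFailure.rate W ρ (fun a => hHat a ω)
        > DeviceFailure.rate W ρ (fun a => h a ω)}
      = 1 / 2
        - 1 / 2 * (σE ^ 2 / (4 - 3 * σE ^ 2)) ^ ((A : ℝ) / 2)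
          * |DeviceFailure.legendreP (A - 1) 0
              ((2 - σE ^ 2) / Real.sqrt (4 * σE ^ 2 - 3 * σE ^ 4))|
        - ∑ a ∈ Finset.Icc 1 (A - 1),
            ((A + a - 1).factorial : ℝ) / ((A - 1).factorial : ℝ)
              * (σE ^ 2 / (4 - 3 * σE ^ 2)) ^ ((A : ℝ) / 2)
              * |DeviceFailure.legendreP (A - 1) a
                  ((2 - σE ^ 2) / Real.sqrt (4 * σE ^ 2 - 3 * σE ^ 4))| := by
  obtain ⟨s, hs⟩ : ∃ s, s = σE ^ 2 := ⟨_, rfl⟩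
  have hs0 : 0 < s := by rw [hs]; positivity
  have hs1 : s < 1 := by rw [hs]; nlinarith
  rw [show σE ^ 4 = s ^ 2 by rw [hs]; ring]
  rw [← hs] at hHat_law hTilde_law ⊢
  obtain ⟨r, hr⟩ : ∃ r, r = √(4 * s - 3 * s ^ 2) := ⟨_, rfl⟩
  rw [← hr]
  have hr2 : r ^ 2 = 4 * s - 3 * s ^ 2 := by rw [hr, Real.sq_sqrt (by nlinarith)]
  have hr0 : 0 < r := by rw [hr]; exact Real.sqrt_pos.2 (by nlinarith)
  have hsr : s < r := by nlinarith
  obtain ⟨t, ht⟩ : ∃ t, t = s / r := ⟨_, rfl⟩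
  have ht0 : 0 < t := by rw [ht]; positivity
  have ht1 : t < 1 := by rw [ht, div_lt_one hr0]; exact hsr
  have hx : (2 - s) / r = (1 + t ^ 2) / (2 * t) := by
    rw [ht]; field_simp; nlinarith
  have hbase : s / (4 - 3 * s) = t ^ 2 := by
    rw [ht, div_pow, hr2, div_eq_div_iff (by linarith) (by nlinarith)]; ring
  have hpow : (s / (4 - 3 * s)) ^ ((A : ℝ) / 2) = t ^ A := by
    rw [hbase, ← Real.rpow_natCast t 2, ← Real.rpow_mul ht0.le, ← Real.rpow_natCast]
    congr 1; push_cast; ring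
  -- The drop of one link has the eigenvalues `(r - s) / 2` and `-(r + s) / 2`, the roots of
  -- `z² + s z - s (1 - s)`; the rates of the exponentials are their inverses in absolute value.
  have hα : 0 < 2 / (r - s) := div_pos two_pos (by linarith)
  have hβ : 0 < 2 / (r + s) := by positivity
  have hrs : r - s ≠ 0 := by linarith
  have hmap := DeviceFailure.map_sum_gainDrop_eq_expDiffMeasure (a := (1 - s).toNNReal) (b := s.toNNReal)
    (by simpa using hs0) hHat_law hTilde_law hindep hα hβ
    (by rw [Real.coe_toNNReal _ hs0.le]; field_simp; ring)
    (by
      rw [Real.coe_toNNReal _ hs0.le, Real.coe_toNNReal _ (by linarith)]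
      field_simp
      nlinarith)
  have hmeas : AEMeasurable (fun ω => ∑ i, DeviceFailure.gainDrop (hHat i ω, hTilde i ω)) P := by
    have hg := DeviceFailure.measurable_gainDrop
    refine Finset.aemeasurable_fun_sum _ fun i _ => ?_
    exact hg.comp_aemeasurable ((hHat_law i).aemeasurable.prodMk (hTilde_law i).aemeasurable)
  have hevent : {ω | DeviceFailure.rate W ρ (fun a => hHat a ω)
        > DeviceFailure.rate W ρ (fun a => h a ω)}
      = (fun ω => ∑ i, DeviceFailure.gainDrop (hHat i ω, hTilde i ω)) ⁻¹' Set.Ioi 0 := by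
    ext ω
    simp only [Set.mem_ofPred_eq, gt_iff_lt, DeviceFailure.rate_lt_rate_iff hW hρ₀ hρ, Set.mem_preimage,
      Set.mem_Ioi, DeviceFailure.gainDrop, Finset.sum_sub_distrib, sub_pos, h_eq]
  rw [hevent, measureReal_def, ← Measure.map_apply_of_aemeasurable hmeas measurableSet_Ioi,
    ← measureReal_def, hmap, DeviceFailure.expDiffMeasure_Ioi hα hβ A A (by omega), hx, hpow]
  have hden : 2 / (r - s) + 2 / (r + s) = 4 * r / ((r - s) * (r + s)) := by
    field_simp; ring
  have hq : 2 / (r - s) / (2 / (r - s) + 2 / (r + s)) = (1 + t) / 2 := by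
    rw [hden, ht]; field_simp; ring
  have hp : 2 / (r + s) / (2 / (r - s) + 2 / (r + s)) = (1 - t) / 2 := by
    rw [hden, ht]; field_simp; ring
  rw [hp, hq]
  obtain ⟨n, rfl⟩ : ∃ n, A = n + 1 := ⟨A - 1, by omega⟩
  rw [show n + 1 + (n + 1) - 1 = 2 * n + 1 by omega, DeviceFailure.binomial_tail_eq_legendreP n ht0 ht1]
  simp only [Nat.add_sub_cancel, show ∀ a, n + 1 + a - 1 = n + a by intro a; omega]
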